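/- **Setup.** Let $N=\{1,\dots,n\}$ be the receivers, $\Omega=\{X,Y\}$ the states, $\lambda^0$ a strictly positive common prior on $\Omega$, and $S_i$ a countably infinite set of messages for each receiver $i$; put $S=\prod_{i\in N}S_i$. An experiment $\pi$ gives, for each state $\omega$, a finitely supported probability distribution $\pi(\cdot\mid\omega)$ on $S$; let $S^\pi$ be the set of signals sent with positive probability in some state. In an undirected (simple) network $g$ on $N$, receiver $i$ observes, upon a signal $s\in S^\pi$, exactly the messages of itself and of its neighbors, forms by Bayes' rule the posterior probability of $X$, and takes action $x$ if this posterior is at least $\tfrac12$ and action $y$ otherwise. For a critical mass $k$, the value of $\pi$ on $g$ is the probability that at least $k$ receivers take action $x$. The value of the network $g$ is the supremum of the values of all experiments on $g$, and $V^n_k$ denotes the value of the empty network on $N$. An extension of $g$ is a network on $N$ obtained from $g$ by adding one or more links; it strictly benefits the sender if its value is strictly larger than the value of $g$. A halo with $m+1$ receivers is a network with exactly $2m$ links in which some $m$ distinct receivers $k_1,\dots,k_m$ satisfy $g_{k_1k_2}=g_{k_2k_3}=\dots=g_{k_{m-1}k_m}=g_{k_mk_1}=1$ and the remaining receiver (the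 center) has degree $m$. **Statement.** Assume $k\ge\lfloor\frac{n+1}{2}\rfloor$ and $\lambda^0(X)<\frac{k}{n+k}$. Let $g$ be a network on $N$ that has a connected component which is a halo with more than $k$ and fewer than $n$ receivers, and exclude the case in which $n=5$ and this component has exactly $4$ receivers (so that $g$ is a complete network on four receivers together with one isolated receiver). Then there is an extension $g'$ of $g$ that strictly benefits the sender and whose value is $V^n_k$. -/

import Mathlib

namespace NetworkPersuasion

/-- The two states of the world. -/
inductive State
  | X
  | Y

/-- The two actions of a receiver. -/
inductive Act
  | x
  | y

/-- The two outcomes. -/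
inductive Outcome
  | x
  | y

/-- A signal assigns a message to every receiver. -/
abbrev Signal {N : Type*} (S : N → Type*) := (i : N) → S i

/-- An experiment: for every state, a finitely supported probability distribution on signals. -/
structure Experiment {N : Type*} (S : N → Type*) where
  prob : State → (Signal S →₀ ℝ)
  nonneg : ∀ ω s, 0 ≤ prob ω s
  sum_eq_one : ∀ ω, ∑ s ∈ (prob ω).support, prob ω s = 1

/-- The neighborhood of a receiver, the receiver included. -/
def nbhd {N : Type*} (g : SimpleGraph N) (i : N) : Set N :=
  {j | g.Adj i j ∨ j = i}

/-- The signals that are sent with positive probability in some state. -/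
def supp {N : Type*} {S : N → Type*} (π : Experiment S) : Set (Signal S) :=
  {s | ∃ ω, 0 < π.prob ω s}

open Classical in
/-- The probability of a set of signals, conditional on the state. -/
noncomputable def probOf {N : Type*} {S : N → Type*} (π : Experiment S) (ω : State)
    (A : Set (Signal S)) : ℝ :=
  ∑ t ∈ (π.prob ω).support with t ∈ A, π.prob ω t

/-- The association set of receiver `i` at the signal `s`: the signals in the support that agree
with `s` on all messages that `i` observes. -/
def assocSet {N : Type*} {S : N → Type*} (g : SimpleGraph N) (π : Experiment S) (i : N)
    (s : Signal S) : Set (Signal S) :=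
  {t | t ∈ supp π ∧ ∀ j ∈ nbhd g i, t j = s j}

/-- The posterior belief of receiver `i` at the signal `s`, by Bayes' rule. It is used only for
`s` in the support, where the denominator is positive (for a positive prior). -/
noncomputable def posterior {N : Type*} {S : N → Type*} (prior : State → ℝ) (g : SimpleGraph N)
    (π : Experiment S) (i : N) (s : Signal S) (ω : State) : ℝ :=
  probOf π ω (assocSet g π i s) * prior ω /
    (probOf π State.X (assocSet g π i s) * prior State.X +
      probOf π State.Y (assocSet g π i s) * prior State.Y)

open Classical in
/-- The action of receiver `i` at the signal `s` (ties are broken in favor of the sender). -/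
noncomputable def action {N : Type*} {S : N → Type*} (prior : State → ℝ) (g : SimpleGraph N)
    (π : Experiment S) (s : Signal S) (i : N) : Act :=
  if 1 / 2 ≤ posterior prior g π i s State.X then Act.x else Act.y

open Classical in
/-- The outcome of an action profile under the critical mass `k`. -/
noncomputable def outcome {N : Type*} (k : ℕ) (a : N → Act) : Outcome :=
  if k ≤ {i | a i = Act.x}.ncard then Outcome.x else Outcome.y

/-- The signals in the support that achieve the critical mass. -/
def successSet {N : Type*} {S : N → Type*} (prior : State → ℝ) (k : ℕ) (g : SimpleGraph N)
    (π : Experiment S) : Set (Signal S) :=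
  {s | s ∈ supp π ∧ outcome k (action prior g π s) = Outcome.x}

/-- The value of an experiment: the probability of reaching the critical mass, that is, the
expected utility of the sender. -/
noncomputable def experimentValue {N : Type*} {S : N → Type*} (prior : State → ℝ) (k : ℕ)
    (g : SimpleGraph N) (π : Experiment S) : ℝ :=
  prior State.X * probOf π State.X (successSet prior k g π) +
    prior State.Y * probOf π State.Y (successSet prior k g π)

/-- The value of a network: the supremum of the values of all experiments. -/
noncomputable def networkValue {N : Type*} (S : N → Type*) (prior : State → ℝ) (k : ℕ)
    (g : SimpleGraph N) : ℝ :=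
  ⨆ π : Experiment S, experimentValue prior k g π

/-- The private value: the value of the empty network on the same receivers. -/
noncomputable def privateValue {N : Type*} (S : N → Type*) (prior : State → ℝ) (k : ℕ) : ℝ :=
  networkValue S prior k (⊥ : SimpleGraph N)

/-- A halo: a network on `m + 1` receivers with exactly `2 * m` links, in which some `m` distinct
receivers are linked in cyclic order and the remaining receiver has degree `m`. -/
def IsHalo {N : Type*} (g : SimpleGraph N) : Prop :=
  ∃ (m : ℕ) (c : Fin m → N) (r : N),
    Nat.card N = m + 1 ∧
    g.edgeSet.ncard = 2 * m ∧
    Function.Injective c ∧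
    (∀ i, c i ≠ r) ∧
    (∀ i, g.Adj (c i) (c (finRotate m i))) ∧
    (g.neighborSet r).ncard = m

end NetworkPersuasion

/-! No network beats λ(X) + nλ(X)/k. In state Y every success uses at least k actions x. By Bayes'
rule the total weight of x-actions in Y is at most λ(X)/λ(Y) times that in X, where it is at most n
(`experimentValue_le`). The empty network attains the bound: a random set of at least k receivers,
containing each one with probability k/n, is persuaded in Y.

A large halo loses a definite amount. Its center observes all that the component observes, so it
recognizes the event that the whole component takes x, which wastes an action because the component
has more than k members. Removing this event from the center's account replaces n by n - 1
(`experimentValue_le_of_nbhd_subset`).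

The extension adds every link except those joining a receiver i to a partner w i. Secret sharing
restores privacy: for each set a of a balanced family, a parity bit is split into shares held by the
partners of the members of a. A member misses its partner's share and learns nothing about the bit;
a nonmember sees all the shares. In X all bits vanish; in Y the sender either announces the state or
flips one bit a, and then exactly the members of a remain persuaded. So the bound is attained
(`le_networkValue_partnerNetwork`).

It remains to choose w on nonlinks of g with w³ = w, and a balanced family whose sets are unions of
fibers of w. Rim receivers are matched across the rim and the rest of the halo with outsiders
(`exists_isGoodPartner`); a complete component on four receivers is treated by hand. -/

namespace NetworkPersuasion

/-! ### Upper bounds by counting x-actions -/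

section UpperBounds

variable {N : Type*} {S : N → Type*}

open Classical in
/-- The signals in the support of an experiment, as a finite set. -/
noncomputable def suppFinset (π : Experiment S) : Finset (Signal S) :=
  (π.prob State.X).support ∪ (π.prob State.Y).support

lemma support_subset_suppFinset (π : Experiment S) (ω : State) :
    (π.prob ω).support ⊆ suppFinset π := by
  classical
  cases ω
  · exact Finset.subset_union_left
  · exact Finset.subset_union_right

lemma mem_supp_of_ne_zero (π : Experiment S) {ω : State} {s : Signal S} (h : π.prob ω s ≠ 0) :
    s ∈ supp π :=
  ⟨ω, lt_of_le_of_ne (π.nonneg ω s) h.symm⟩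

lemma mem_suppFinset (π : Experiment S) (s : Signal S) : s ∈ suppFinset π ↔ s ∈ supp π := by
  classical
  constructor
  · intro h
    rcases Finset.mem_union.1 h with h | h
    · exact mem_supp_of_ne_zero π (Finsupp.mem_support_iff.1 h)
    · exact mem_supp_of_ne_zero π (Finsupp.mem_support_iff.1 h)
  · rintro ⟨ω, h⟩
    exact support_subset_suppFinset π ω (Finsupp.mem_support_iff.2 h.ne')

lemma probOf_eq_sum_indicator (π : Experiment S) (ω : State) (A : Set (Signal S)) :
    probOf π ω A = ∑ s ∈ suppFinset π, A.indicator (π.prob ω) s := by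
  classical
  rw [probOf, Finset.sum_filter]
  rw [Finset.sum_subset (support_subset_suppFinset π ω)]
  · exact Finset.sum_congr rfl fun s _ => by simp [Set.indicator_apply]
  · intro s _ hs
    simp [Finsupp.notMem_support_iff.1 hs]

lemma sum_suppFinset (π : Experiment S) (ω : State) :
    ∑ s ∈ suppFinset π, π.prob ω s = 1 := by
  rw [← π.sum_eq_one ω]
  refine (Finset.sum_subset (support_subset_suppFinset π ω) ?_).symm
  intro s _ hs
  exact Finsupp.notMem_support_iff.1 hs

lemma probOf_nonneg (π : Experiment S) (ω : State) (A : Set (Signal S)) : 0 ≤ probOf π ω A :=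
  Finset.sum_nonneg fun s _ => π.nonneg ω s

lemma probOf_le_one (π : Experiment S) (ω : State) (A : Set (Signal S)) : probOf π ω A ≤ 1 := by
  rw [probOf_eq_sum_indicator, ← sum_suppFinset π ω]
  exact Finset.sum_le_sum fun s _ => Set.indicator_le_self' (fun s _ => π.nonneg ω s) s

lemma le_of_half_le_div {a b : ℝ} (ha : 0 ≤ a) (hb : 0 ≤ b) (h : 1 / 2 ≤ a / (a + b)) : b ≤ a := by
  -- If a + b = 0 the quotient is 0 by convention, hence below 1/2.
  rcases (add_nonneg ha hb).eq_or_lt with h0 | h0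
  · rw [← h0, div_zero] at h
    norm_num at h
  · rw [le_div_iff₀ h0] at h
    linarith

lemma half_le_div {a b : ℝ} (hab : 0 < a + b) (h : b ≤ a) : 1 / 2 ≤ a / (a + b) := by
  rw [le_div_iff₀ hab]
  linarith

variable {prior : State → ℝ}

lemma probOf_assocSet_le (hpos : ∀ ω, 0 < prior ω)
    {g : SimpleGraph N} {π : Experiment S} {i : N} {s : Signal S}
    (h : action prior g π s i = Act.x) :
    prior State.Y * probOf π State.Y (assocSet g π i s) ≤
      prior State.X * probOf π State.X (assocSet g π i s) := by
  have h2 : 1 / 2 ≤ posterior prior g π i s State.X := by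
    by_contra hc
    rw [action, if_neg hc] at h
    exact Act.noConfusion h
  have := le_of_half_le_div (mul_nonneg (probOf_nonneg π State.X _) (hpos State.X).le)
    (mul_nonneg (probOf_nonneg π State.Y _) (hpos State.Y).le) h2
  linarith

/-- On an event that receiver `i` observes and at which it takes action `x`, the state `X` is at
least as likely as the state `Y`. -/
lemma probOf_le_of_action_eq_x (hpos : ∀ ω, 0 < prior ω)
    {g : SimpleGraph N} {π : Experiment S} {i : N}
    {E : Set (Signal S)}
    (hmeas : ∀ s ∈ supp π, ∀ t ∈ supp π, (∀ j ∈ nbhd g i, t j = s j) → s ∈ E → t ∈ E)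
    (hE : ∀ s ∈ supp π, s ∈ E → action prior g π s i = Act.x) :
    prior State.Y * probOf π State.Y E ≤ prior State.X * probOf π State.X E := by
  classical
  let view : Signal S → ((j : nbhd g i) → S j) := fun s j => s j
  let F := (suppFinset π).filter (· ∈ E)
  have hF : ∀ ω, probOf π ω E = ∑ s ∈ F, π.prob ω s := by
    intro ω
    rw [probOf_eq_sum_indicator, Finset.sum_filter]
    exact Finset.sum_congr rfl fun s _ => by simp [Set.indicator_apply]
  -- E is a union of classes of signals that look alike to i; the Bayes inequality holds on each
  -- class and is summed.
  have hfib : ∀ ω, probOf π ω E =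
      ∑ v ∈ F.image view, ∑ s ∈ F with view s = v, π.prob ω s := by
    intro ω
    rw [hF, Finset.sum_fiberwise_of_maps_to fun s hs => Finset.mem_image_of_mem view hs]
  rw [hfib, hfib, Finset.mul_sum, Finset.mul_sum]
  refine Finset.sum_le_sum fun v hv => ?_
  obtain ⟨s, hs, rfl⟩ := Finset.mem_image.1 hv
  have hs' : s ∈ supp π ∧ s ∈ E := by
    rw [← mem_suppFinset]
    exact Finset.mem_filter.1 hs
  have hcls : ∀ ω, ∑ t ∈ F with view t = view s, π.prob ω t = probOf π ω (assocSet g π i s) := by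
    intro ω
    rw [probOf_eq_sum_indicator, Finset.sum_filter, Finset.sum_filter]
    refine Finset.sum_congr rfl fun t ht => ?_
    have ht' := (mem_suppFinset π t).1 ht
    have hv : view t = view s ↔ ∀ j ∈ nbhd g i, t j = s j :=
      ⟨fun h j hj => congrFun h ⟨j, hj⟩, fun h => funext fun j => h j j.2⟩
    rw [Set.indicator_apply]
    by_cases hts : ∀ j ∈ nbhd g i, t j = s j
    · have hmem : t ∈ assocSet g π i s := ⟨ht', hts⟩
      simp [hmem, hv.2 hts, hmeas s hs'.1 t ht' hts hs'.2]
    · have hmem : t ∉ assocSet g π i s := fun h => hts h.2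
      simp [hmem, mt hv.1 hts]
  rw [hcls, hcls]
  exact probOf_assocSet_le hpos (hE s hs'.1 hs'.2)

/-- The action of a receiver depends only on what it observes. -/
lemma action_congr {g : SimpleGraph N} {π : Experiment S} {i : N} {s t : Signal S}
    (h : ∀ j ∈ nbhd g i, t j = s j) : action prior g π t i = action prior g π s i := by
  have : assocSet g π i t = assocSet g π i s := by
    ext u
    simp only [assocSet, Set.mem_ofPred_eq]
    refine and_congr_right fun _ => forall₂_congr fun j hj => ?_
    rw [h j hj]
  have hp : posterior prior g π i t State.X = posterior prior g π i s State.X := by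
    rw [posterior, posterior, this]
  rw [action, action, hp]

/-- The event that receiver `i` takes action `x`. -/
def actX (prior : State → ℝ) (g : SimpleGraph N) (π : Experiment S) (i : N) : Set (Signal S) :=
  {s | action prior g π s i = Act.x}

lemma mem_successSet_iff {k : ℕ} {g : SimpleGraph N} {π : Experiment S} {s : Signal S} :
    s ∈ successSet prior k g π ↔
      s ∈ supp π ∧ k ≤ {i | action prior g π s i = Act.x}.ncard := by
  simp only [successSet, outcome, Set.mem_ofPred_eq]
  refine and_congr_right fun _ => ?_
  split_ifs with h <;> simp [h]

lemma probOf_actX_le (hpos : ∀ ω, 0 < prior ω) (g : SimpleGraph N) (π : Experiment S) (i : N) :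
    prior State.Y * probOf π State.Y (actX prior g π i) ≤
      prior State.X * probOf π State.X (actX prior g π i) :=
  probOf_le_of_action_eq_x hpos (i := i) (g := g)
    (fun _ _ _ _ h hs => (action_congr h).trans hs) (fun _ _ h => h)

variable [Fintype N]

lemma sum_indicator_actX (g : SimpleGraph N) (π : Experiment S) (v : Signal S → ℝ)
    (s : Signal S) : ∑ i, (actX prior g π i).indicator v s =
      ({i | action prior g π s i = Act.x}.ncard : ℝ) * v s := by
  classical
  simp only [Set.indicator_apply, actX, Set.mem_ofPred_eq]
  rw [Finset.sum_ite, Finset.sum_const, Finset.sum_const_zero, add_zero, nsmul_eq_mul,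
    Set.ncard_eq_toFinset_card']
  congr 3
  ext i
  simp

lemma sum_probOf_actX (g : SimpleGraph N) (π : Experiment S) (ω : State) :
    ∑ i, probOf π ω (actX prior g π i) = ∑ s ∈ suppFinset π,
      ({i | action prior g π s i = Act.x}.ncard : ℝ) * π.prob ω s := by
  simp only [probOf_eq_sum_indicator]
  rw [Finset.sum_comm]
  exact Finset.sum_congr rfl fun s _ => sum_indicator_actX g π _ s

lemma ncard_action_le (g : SimpleGraph N) (π : Experiment S) (s : Signal S) :
    ({i | action prior g π s i = Act.x}.ncard : ℝ) ≤ Fintype.card N := by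
  rw [← Nat.card_eq_fintype_card]
  exact_mod_cast Set.ncard_le_card _

/-- Double counting: k · P(success | Y) is at most the expected number of x-actions in Y, which
obedience bounds by λ(X)/λ(Y) times that in X, itself at most the number of receivers. -/
lemma experimentValue_le (hpos : ∀ ω, 0 < prior ω)
    {k : ℕ} (hk : 0 < k) (g : SimpleGraph N) (π : Experiment S) :
    experimentValue prior k g π ≤
      prior State.X + Fintype.card N * prior State.X / k := by
  have hY : k * probOf π State.Y (successSet prior k g π) ≤
      ∑ i, probOf π State.Y (actX prior g π i) := by
    rw [sum_probOf_actX, probOf_eq_sum_indicator, Finset.mul_sum]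
    refine Finset.sum_le_sum fun s _ => ?_
    by_cases hs : s ∈ successSet prior k g π
    · rw [Set.indicator_of_mem hs]
      exact mul_le_mul_of_nonneg_right (by exact_mod_cast (mem_successSet_iff.1 hs).2)
        (π.nonneg _ s)
    · rw [Set.indicator_of_notMem hs, mul_zero]
      exact mul_nonneg (Nat.cast_nonneg _) (π.nonneg _ s)
  have hX : ∑ i, probOf π State.X (actX prior g π i) ≤ Fintype.card N := by
    refine (Finset.sum_le_sum fun i _ => probOf_le_one π State.X _).trans ?_
    simp
  have hXY : prior State.Y * ∑ i, probOf π State.Y (actX prior g π i) ≤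
      prior State.X * ∑ i, probOf π State.X (actX prior g π i) := by
    rw [Finset.mul_sum, Finset.mul_sum]
    exact Finset.sum_le_sum fun i _ => probOf_actX_le hpos g π i
  have hk' : (0 : ℝ) < k := by exact_mod_cast hk
  have h1 := mul_le_mul_of_nonneg_left hY (hpos State.Y).le
  have h2 := mul_le_mul_of_nonneg_left hX (hpos State.X).le
  have h3 := mul_le_mul_of_nonneg_left (probOf_le_one π State.X (successSet prior k g π))
    (hpos State.X).le
  have h4 : prior State.Y * probOf π State.Y (successSet prior k g π) ≤
      Fintype.card N * prior State.X / k := by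
    rw [le_div_iff₀ hk']
    linarith
  rw [experimentValue]
  linarith

/-- If a receiver `r` observes everything that the more than `k` receivers in `C` observe, then no
experiment comes close to the private value. -/
lemma experimentValue_le_of_nbhd_subset (hpos : ∀ ω, 0 < prior ω)
    {k : ℕ} (hk : 0 < k) (g : SimpleGraph N)
    (π : Experiment S) {C : Set N} {r : N} (hr : r ∈ C) (hkC : k < C.ncard)
    (hC : ∀ i ∈ C, nbhd g i ⊆ nbhd g r) :
    experimentValue prior k g π ≤
      prior State.X + (Fintype.card N - 1) * prior State.X / k := by
  classical
  set G : Set (Signal S) := {s | ∀ i ∈ C, action prior g π s i = Act.x} with hG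
  have hcG : ∀ s ∈ G, (k : ℝ) + 1 ≤ ({i | action prior g π s i = Act.x}.ncard : ℝ) := by
    intro s hs
    have : C.ncard ≤ {i | action prior g π s i = Act.x}.ncard :=
      Set.ncard_le_ncard (fun i hi => hs i hi) (Set.toFinite _)
    exact_mod_cast hkC.trans_le this
  have hnG : ∀ s ∉ G, ({i | action prior g π s i = Act.x}.ncard : ℝ) ≤ Fintype.card N - 1 := by
    intro s hs
    have : {i | action prior g π s i = Act.x}.ncard < Fintype.card N := by
      rw [← Nat.card_eq_fintype_card]
      refine Set.ncard_lt_card fun h => hs fun i _ => ?_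
      have : i ∈ {i | action prior g π s i = Act.x} := h ▸ Set.mem_univ i
      exact this
    have h2 : {i | action prior g π s i = Act.x}.ncard + 1 ≤ Fintype.card N := this
    have h3 : ({i | action prior g π s i = Act.x}.ncard : ℝ) + 1 ≤ Fintype.card N := by
      exact_mod_cast h2
    linarith
  have hGr : G ⊆ actX prior g π r := fun s hs => hs r hr
  have hdiff : ∀ ω, probOf π ω (actX prior g π r) =
      probOf π ω G + probOf π ω (actX prior g π r \ G) := by
    intro ω
    simp only [probOf_eq_sum_indicator]
    rw [← Finset.sum_add_distrib]
    refine Finset.sum_congr rfl fun s _ => ?_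
    have := congrFun (Set.indicator_union_of_disjoint
      (Set.disjoint_sdiff_right (s := G) (t := actX prior g π r)) (π.prob ω)) s
    rw [Set.union_sdiff_cancel hGr] at this
    exact this
  -- Since r sees whatever determines the actions in C, it can tell whether G occurs, so obedience
  -- also holds off G.
  have hrG : prior State.Y * probOf π State.Y (actX prior g π r \ G) ≤
      prior State.X * probOf π State.X (actX prior g π r \ G) := by
    refine probOf_le_of_action_eq_x hpos (i := r) (g := g) ?_ (fun _ _ h => h.1)
    intro s _ t _ h hs
    refine ⟨(action_congr h).trans hs.1, fun ht => hs.2 fun i hi => ?_⟩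
    rw [← action_congr fun j hj => h j (hC i hi hj)]
    exact ht i hi
  -- On G at least k + 1 receivers take x, which pays for the extra term.
  have hY : k * probOf π State.Y (successSet prior k g π) + probOf π State.Y G ≤
      ∑ i, probOf π State.Y (actX prior g π i) := by
    rw [sum_probOf_actX, probOf_eq_sum_indicator, probOf_eq_sum_indicator, Finset.mul_sum,
      ← Finset.sum_add_distrib]
    refine Finset.sum_le_sum fun s hs => ?_
    have h0 := π.nonneg State.Y s
    have hsupp := (mem_suppFinset π s).1 hs
    by_cases hsG : s ∈ G
    · have h1 := hcG s hsG
      rw [Set.indicator_of_mem hsG]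
      have := mul_le_mul_of_nonneg_right h1 h0
      have h2 : (k : ℝ) * (successSet prior k g π).indicator (π.prob State.Y) s ≤
          k * π.prob State.Y s :=
        mul_le_mul_of_nonneg_left (Set.indicator_le_self' (fun s _ => π.nonneg _ s) s)
          (Nat.cast_nonneg _)
      linarith
    · rw [Set.indicator_of_notMem hsG, add_zero]
      by_cases hs : s ∈ successSet prior k g π
      · rw [Set.indicator_of_mem hs]
        exact mul_le_mul_of_nonneg_right (by exact_mod_cast (mem_successSet_iff.1 hs).2) h0
      · rw [Set.indicator_of_notMem hs, mul_zero]
        exact mul_nonneg (Nat.cast_nonneg _) h0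
  -- On G the count is at most n and one is subtracted; off G somebody in C takes y.
  have hX : ∑ i, probOf π State.X (actX prior g π i) - probOf π State.X G ≤
      Fintype.card N - 1 := by
    have h1 : ((Fintype.card N : ℝ) - 1) =
        ∑ s ∈ suppFinset π, ((Fintype.card N : ℝ) - 1) * π.prob State.X s := by
      rw [← Finset.mul_sum, sum_suppFinset, mul_one]
    rw [h1, sum_probOf_actX, probOf_eq_sum_indicator, ← Finset.sum_sub_distrib]
    refine Finset.sum_le_sum fun s _ => ?_
    have h0 := π.nonneg State.X s
    by_cases hsG : s ∈ G
    · rw [Set.indicator_of_mem hsG]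
      have := mul_le_mul_of_nonneg_right (ncard_action_le (prior := prior) g π s) h0
      linarith
    · rw [Set.indicator_of_notMem hsG, sub_zero]
      exact mul_le_mul_of_nonneg_right (hnG s hsG) h0
  have hXY : prior State.Y * (∑ i, probOf π State.Y (actX prior g π i) - probOf π State.Y G) ≤
      prior State.X * (∑ i, probOf π State.X (actX prior g π i) - probOf π State.X G) := by
    rw [← Finset.add_sum_erase _ _ (Finset.mem_univ r), ← Finset.add_sum_erase _ _
      (Finset.mem_univ r), hdiff State.X, hdiff State.Y]
    have h1 : prior State.Y * ∑ i ∈ Finset.univ.erase r, probOf π State.Y (actX prior g π i) ≤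
        prior State.X * ∑ i ∈ Finset.univ.erase r, probOf π State.X (actX prior g π i) := by
      rw [Finset.mul_sum, Finset.mul_sum]
      exact Finset.sum_le_sum fun i _ => probOf_actX_le hpos g π i
    linarith
  have hk' : (0 : ℝ) < k := by exact_mod_cast hk
  have h1 := mul_le_mul_of_nonneg_left hY (hpos State.Y).le
  have h2 := mul_le_mul_of_nonneg_left hX (hpos State.X).le
  have h3 := mul_le_mul_of_nonneg_left (probOf_le_one π State.X (successSet prior k g π))
    (hpos State.X).le
  have h4 : prior State.Y * probOf π State.Y (successSet prior k g π) ≤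
      (Fintype.card N - 1) * prior State.X / k := by
    rw [le_div_iff₀ hk']
    linarith
  rw [experimentValue]
  linarith

end UpperBounds

/-! ### Experiments from finite weighted models -/

section FiniteModels

variable {N : Type*} {S : N → Type*} {T : Type*} [Fintype T]

/-- Points with the same signal pool their weights, so `f` need not be injective. -/
lemma sum_single_sum (f : T → Signal S) (μ : T → ℝ) (h : Signal S → ℝ) :
    (∑ t, Finsupp.single (f t) (μ t)).sum (fun s r => h s * r) = ∑ t, h (f t) * μ t := by
  classical
  rw [← Finsupp.sum_finsetSum_index (by simp) (by intros; ring)]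
  simp

/-- The experiment that draws an element of a finite type and sends the signal attached to it. -/
noncomputable def Experiment.ofWeights (f : T → Signal S) (μ : State → T → ℝ)
    (h0 : ∀ ω t, 0 ≤ μ ω t) (h1 : ∀ ω, ∑ t, μ ω t = 1) : Experiment S where
  prob ω := ∑ t, Finsupp.single (f t) (μ ω t)
  nonneg ω s := by
    classical
    rw [Finsupp.finsetSum_apply]
    refine Finset.sum_nonneg fun t _ => ?_
    rw [Finsupp.single_apply]
    split_ifs
    · exact h0 ω t
    · exact le_rfl
  sum_eq_one ω := by
    have := sum_single_sum f (μ ω) (fun _ => 1)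
    simp only [one_mul, h1, Finsupp.sum] at this
    exact this

variable {f : T → Signal S} {μ : State → T → ℝ} {h0 : ∀ ω t, 0 ≤ μ ω t}
  {h1 : ∀ ω, ∑ t, μ ω t = 1}

lemma probOf_ofWeights (ω : State) (A : Set (Signal S)) :
    probOf (Experiment.ofWeights f μ h0 h1) ω A = ∑ t, A.indicator 1 (f t) * μ ω t := by
  classical
  rw [← sum_single_sum f (μ ω), probOf, Finset.sum_filter, Finsupp.sum]
  refine Finset.sum_congr rfl fun s _ => ?_
  rw [Set.indicator_apply]
  split_ifs <;> simp [Experiment.ofWeights]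

lemma mem_supp_ofWeights {ω : State} {t : T} (h : 0 < μ ω t) :
    f t ∈ supp (Experiment.ofWeights f μ h0 h1) := by
  classical
  refine ⟨ω, h.trans_le ?_⟩
  change μ ω t ≤ (∑ t, Finsupp.single (f t) (μ ω t)) (f t)
  rw [Finsupp.finsetSum_apply]
  have := Finset.single_le_sum (f := fun u => (Finsupp.single (f u) (μ ω u)) (f t))
    (fun u _ => by
      rw [Finsupp.single_apply]
      split_ifs
      · exact h0 ω u
      · exact le_rfl) (Finset.mem_univ t)
  simpa using this

open Classical in
/-- The conditional probability of what receiver `i` observes at the signal attached to `t`. -/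
noncomputable def viewWeight (g : SimpleGraph N) (f : T → Signal S) (μ : T → ℝ) (i : N) (t : T) :
    ℝ :=
  ∑ u, if ∀ j ∈ nbhd g i, f u j = f t j then μ u else 0

lemma probOf_assocSet_ofWeights (g : SimpleGraph N) (ω : State) (i : N) (t : T) :
    probOf (Experiment.ofWeights f μ h0 h1) ω
      (assocSet g (Experiment.ofWeights f μ h0 h1) i (f t)) = viewWeight g f (μ ω) i t := by
  classical
  rw [probOf_ofWeights, viewWeight]
  refine Finset.sum_congr rfl fun u _ => ?_
  -- A point of weight zero may send a signal outside the support, but then it contributes nothing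
  -- to either side.
  rcases (h0 ω u).eq_or_lt with hu | hu
  · simp [← hu]
  · have hs := mem_supp_ofWeights (h0 := h0) (h1 := h1) (f := f) hu
    rw [Set.indicator_apply]
    simp [assocSet, hs]

lemma le_viewWeight (h0 : ∀ ω t, 0 ≤ μ ω t) (g : SimpleGraph N) (ω : State) (i : N) (t : T) :
    μ ω t ≤ viewWeight g f (μ ω) i t := by
  classical
  have := Finset.single_le_sum
    (f := fun u => if ∀ j ∈ nbhd g i, f u j = f t j then μ ω u else 0)
    (fun u _ => by
      split_ifs
      · exact h0 ω u
      · exact le_rfl) (Finset.mem_univ t)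
  simpa [viewWeight] using this

variable {prior : State → ℝ}

/-- Positive weight at `t` keeps the Bayes denominator positive; otherwise the posterior would be
0/0 = 0 and the action y. -/
lemma action_ofWeights_eq_x (hpos : ∀ ω, 0 < prior ω) {g : SimpleGraph N} {i : N} {t : T}
    (ht : ∃ ω, 0 < μ ω t)
    (h : prior State.Y * viewWeight g f (μ State.Y) i t ≤
      prior State.X * viewWeight g f (μ State.X) i t) :
    action prior g (Experiment.ofWeights f μ h0 h1) (f t) i = Act.x := by
  have hX := le_viewWeight (f := f) h0 g State.X i t
  have hY := le_viewWeight (f := f) h0 g State.Y i t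
  have h2 : 1 / 2 ≤ posterior prior g (Experiment.ofWeights f μ h0 h1) i (f t) State.X := by
    rw [posterior, probOf_assocSet_ofWeights, probOf_assocSet_ofWeights]
    refine half_le_div ?_ (by linarith)
    have hX0 := (h0 State.X t).trans hX
    have hY0 := (h0 State.Y t).trans hY
    obtain ⟨ω, hω⟩ := ht
    cases ω
    · have := mul_pos (hω.trans_le hX) (hpos State.X)
      have := mul_nonneg hY0 (hpos State.Y).le
      linarith
    · have := mul_pos (hω.trans_le hY) (hpos State.Y)
      have := mul_nonneg hX0 (hpos State.X).le
      linarith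
  simp only [action, if_pos h2]

variable [Fintype N]

lemma bddAbove_experimentValue (hpos : ∀ ω, 0 < prior ω) {k : ℕ} (hk : 0 < k)
    (g : SimpleGraph N) :
    BddAbove (Set.range fun π : Experiment S => experimentValue prior k g π) := by
  refine ⟨prior State.X + Fintype.card N * prior State.X / k, ?_⟩
  rintro _ ⟨π, rfl⟩
  exact experimentValue_le hpos hk g π

/-- A lower bound for the value of a network from a finite model of an experiment: at each relevant
point `t`, the receivers in `D t` find the state `X` at least as likely as `Y`. -/
lemma le_networkValue_of_weights (hpos : ∀ ω, 0 < prior ω) {k : ℕ} (hk : 0 < k)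
    (g : SimpleGraph N) (f : T → Signal S) (μ : State → T → ℝ) (h0 : ∀ ω t, 0 ≤ μ ω t)
    (h1 : ∀ ω, ∑ t, μ ω t = 1) (D : T → Finset N) (A : Finset T)
    (hD : ∀ t ∈ A, (∃ ω, 0 < μ ω t) → k ≤ (D t).card)
    (hobey : ∀ t ∈ A, ∀ i ∈ D t, prior State.Y * viewWeight g f (μ State.Y) i t ≤
      prior State.X * viewWeight g f (μ State.X) i t) :
    prior State.X * ∑ t ∈ A, μ State.X t + prior State.Y * ∑ t ∈ A, μ State.Y t ≤
      networkValue S prior k g := by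
  classical
  refine le_trans ?_ (le_ciSup (bddAbove_experimentValue hpos hk g)
    (Experiment.ofWeights f μ h0 h1))
  have key : ∀ ω, ∑ t ∈ A, μ ω t ≤ probOf (Experiment.ofWeights f μ h0 h1) ω
      (successSet prior k g (Experiment.ofWeights f μ h0 h1)) := by
    intro ω
    rw [probOf_ofWeights]
    have hterm : ∀ t, 0 ≤ (successSet prior k g (Experiment.ofWeights f μ h0 h1)).indicator
        (1 : Signal S → ℝ) (f t) * μ ω t := fun t =>
      mul_nonneg (Set.indicator_nonneg (fun _ _ => zero_le_one) _) (h0 ω t)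
    refine le_trans (Finset.sum_le_sum fun t ht => ?_)
      (Finset.sum_le_sum_of_subset_of_nonneg (Finset.subset_univ A) fun t _ _ => hterm t)
    rcases (h0 ω t).eq_or_lt with hu | hu
    · exact hu ▸ hterm t
    · have hmem : f t ∈ successSet prior k g (Experiment.ofWeights f μ h0 h1) := by
        refine mem_successSet_iff.2 ⟨mem_supp_ofWeights hu, (hD t ht ⟨ω, hu⟩).trans ?_⟩
        rw [← Set.ncard_coe_finset]
        refine Set.ncard_le_ncard (fun i hi => ?_) (Set.toFinite _)
        exact action_ofWeights_eq_x hpos ⟨ω, hu⟩ (hobey t ht i hi)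
      simp [Set.indicator_of_mem hmem]
  exact add_le_add (mul_le_mul_of_nonneg_left (key _) (hpos _).le)
    (mul_le_mul_of_nonneg_left (key _) (hpos _).le)

end FiniteModels

/-! ### Balanced families of receivers -/

section Families

/-- A random set of at least `k` receivers that contains every receiver with probability
`k / |N|`. -/
structure BalancedFamily (N : Type*) [Fintype N] [DecidableEq N] (k : ℕ) (ι : Type*)
    [Fintype ι] where
  weight : ι → ℝ
  set : ι → Finset N
  weight_nonneg : ∀ a, 0 ≤ weight a
  sum_weight : ∑ a, weight a = 1
  le_card : ∀ a, k ≤ (set a).card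
  marginal : ∀ i, ∑ a, (if i ∈ set a then weight a else 0) = (k : ℝ) / Fintype.card N

/-- A balanced family all of whose sets are transported along a bijection. -/
def BalancedFamily.map {M N ι : Type*} [Fintype M] [Fintype N] [DecidableEq M]
    [DecidableEq N] [Fintype ι] {k : ℕ}
    (B : BalancedFamily M k ι) (e : M ≃ N) : BalancedFamily N k ι where
  weight := B.weight
  set a := (B.set a).map e.toEmbedding
  weight_nonneg := B.weight_nonneg
  sum_weight := B.sum_weight
  le_card a := by simpa using B.le_card a
  marginal i := by
    rw [← Fintype.card_congr e, ← B.marginal (e.symm i)]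
    simp [Finset.mem_map_equiv]

/-- The cyclic interval of length `j` that ends in `t`. -/
def arc {m : ℕ} (j : ℕ) (t : Fin m) : Finset (Fin m) :=
  Finset.univ.filter fun s => (t - s : Fin m).val < j

lemma card_filter_val_lt {m j : ℕ} (hj : j ≤ m) :
    (Finset.univ.filter fun u : Fin m => u.val < j).card = j := by
  rw [Fin.card_filter_val_lt, min_eq_right hj]

lemma card_arc {m j : ℕ} [NeZero m] (hj : j ≤ m) (t : Fin m) : (arc j t).card = j := by
  conv_rhs => rw [← card_filter_val_lt hj]
  exact Finset.card_equiv (Equiv.subLeft t) fun s => by simp [arc]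

lemma card_arc_containing {m j : ℕ} [NeZero m] (hj : j ≤ m) (s : Fin m) :
    (Finset.univ.filter fun t : Fin m => s ∈ arc j t).card = j := by
  conv_rhs => rw [← card_filter_val_lt hj]
  exact Finset.card_equiv (Equiv.subRight s) fun t => by simp [arc]

/-- The uniform family of cyclic intervals. -/
noncomputable def BalancedFamily.cyclic {n k : ℕ} [NeZero n] (hk : k ≤ n) :
    BalancedFamily (Fin n) k (Fin n) where
  weight _ := 1 / n
  set t := arc k t
  weight_nonneg _ := by positivity
  sum_weight := by simp [NeZero.ne]
  le_card t := (card_arc hk t).ge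
  marginal s := by
    rw [← Finset.sum_filter, Finset.sum_const, card_arc_containing hk, nsmul_eq_mul,
      Fintype.card_fin]
    ring

/-- A balanced family of sets that contain both receivers of the pair `Fin 2` or neither. -/
noncomputable def BalancedFamily.paired {m k : ℕ} [NeZero m] (hk2 : 2 ≤ k) (hkm : k ≤ m) :
    BalancedFamily (Fin m ⊕ Fin 2) k (Fin m ⊕ Fin m) where
  -- The pair is included with its required marginal k/(m + 2). The others then get k/(m + 2) · (k -
  -- 2)/m + (m + 2 - k)/(m + 2) · k/m = k/(m + 2).
  weight := Sum.elim (fun _ => (k : ℝ) / (m + 2) / m) (fun _ => ((m : ℝ) + 2 - k) / (m + 2) / m)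
  set := Sum.elim (fun t => (arc (k - 2) t).disjSum Finset.univ)
    (fun t => (arc k t).disjSum ∅)
  weight_nonneg := by
    have : (k : ℝ) ≤ m := by exact_mod_cast hkm
    rintro (t | t)
    · simp only [Sum.elim_inl]; positivity
    · simp only [Sum.elim_inr]
      have : (0 : ℝ) ≤ (m : ℝ) + 2 - k := by linarith
      positivity
  sum_weight := by
    have : (m : ℝ) ≠ 0 := by exact_mod_cast NeZero.ne m
    have : (m : ℝ) + 2 ≠ 0 := by positivity
    simp
    field_simp
    ring
  le_card := by
    rintro (t | t)
    · simp [card_arc (show k - 2 ≤ m by omega)]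
      omega
    · simp [card_arc hkm]
  marginal := by
    have : (m : ℝ) ≠ 0 := by exact_mod_cast NeZero.ne m
    have : (m : ℝ) + 2 ≠ 0 := by positivity
    rintro (s | s)
    · simp only [Fintype.sum_sum_type, Sum.elim_inl, Sum.elim_inr, Finset.inl_mem_disjSum]
      rw [← Finset.sum_filter, Finset.sum_const, card_arc_containing (show k - 2 ≤ m by omega),
        ← Finset.sum_filter, Finset.sum_const, card_arc_containing hkm]
      simp [Nat.cast_sub hk2]
      field_simp
      ring
    · simp only [Fintype.sum_sum_type, Sum.elim_inl, Sum.elim_inr, Finset.inr_mem_disjSum]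
      simp
      field_simp

end Families

/-! ### The value of the empty network -/

section PrivateValue

variable {N : Type*} [Fintype N] {S : N → Type*} [∀ i, Infinite (S i)]
  {prior : State → ℝ} {ι : Type*} [Fintype ι]

/-- The probability, given `Y`, with which the sender can reach the critical mass. -/
noncomputable def successRate (N : Type*) [Fintype N] (prior : State → ℝ) (k : ℕ) : ℝ :=
  Fintype.card N * prior State.X / (k * prior State.Y)

lemma successRate_nonneg (hpos : ∀ ω, 0 < prior ω) (k : ℕ) : 0 ≤ successRate N prior k :=
  div_nonneg (mul_nonneg (Nat.cast_nonneg _) (hpos _).le)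
    (mul_nonneg (Nat.cast_nonneg _) (hpos _).le)

/-- The bound on the prior says nλ(X) < kλ(Y). -/
lemma successRate_le_one (hpos : ∀ ω, 0 < prior ω) (hsum : prior State.X + prior State.Y = 1)
    {k : ℕ} (hk : 0 < k)
    (hprior : prior State.X < (k : ℝ) / ((Fintype.card N : ℝ) + (k : ℝ))) :
    successRate N prior k ≤ 1 := by
  have hk' : (0 : ℝ) < k := by exact_mod_cast hk
  have hY := hpos State.Y
  rw [lt_div_iff₀ (by positivity)] at hprior
  rw [successRate, div_le_one (by positivity)]
  have : prior State.Y = 1 - prior State.X := by linarith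
  rw [this]
  linarith

lemma prior_mul_successRate (hpos : ∀ ω, 0 < prior ω) {k : ℕ} :
    prior State.Y * successRate N prior k = Fintype.card N * prior State.X / k := by
  have hY := (hpos State.Y).ne'
  rw [successRate]
  field_simp

/-- The indifference identity: a receiver persuaded always in X, and in Y with probability c · k/n,
has posterior exactly 1/2. -/
lemma prior_mul_successRate_mul (hpos : ∀ ω, 0 < prior ω) {k : ℕ} (hk : 0 < k) (i : N) :
    prior State.Y * (successRate N prior k * ((k : ℝ) / Fintype.card N)) = prior State.X := by
  have : Nonempty N := ⟨i⟩
  have hk' : (k : ℝ) ≠ 0 := by exact_mod_cast hk.ne'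
  have hN : (Fintype.card N : ℝ) ≠ 0 := by exact_mod_cast Fintype.card_ne_zero
  rw [← mul_assoc, prior_mul_successRate hpos]
  field_simp

/-- The weights of the private experiment. -/
noncomputable def privateWeight (c : ℝ) (w : ι → ℝ) : State → Option (Option ι) → ℝ
  | State.X, none => 1
  | State.X, some _ => 0
  | State.Y, none => 0
  | State.Y, some none => 1 - c
  | State.Y, some (some a) => c * w a

/-- Two messages per receiver suffice: `u` goes to everybody in X and, in Y, with probability c to
the members of a random set of the family; `v` goes to all others. -/
lemma le_networkValue_bot [DecidableEq N] (hpos : ∀ ω, 0 < prior ω)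
    (hsum : prior State.X + prior State.Y = 1)
    {k : ℕ} (hk : 0 < k) (hkN : k ≤ Fintype.card N)
    (hprior : prior State.X < (k : ℝ) / ((Fintype.card N : ℝ) + (k : ℝ)))
    (B : BalancedFamily N k ι) :
    prior State.X + Fintype.card N * prior State.X / k ≤
      networkValue S prior k (⊥ : SimpleGraph N) := by
  classical
  set c := successRate N prior k with hc
  have hc0 : 0 ≤ c := successRate_nonneg hpos k
  have hc1 : c ≤ 1 := successRate_le_one hpos hsum hk hprior
  choose u v huv using fun i => exists_pair_ne (S i)
  let D : Option (Option ι) → Finset N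
    | none => Finset.univ
    | some none => ∅
    | some (some a) => B.set a
  let f : Option (Option ι) → Signal S := fun t j => if j ∈ D t then u j else v j
  have hf : ∀ t t' i, i ∈ D t' →
      ((∀ j ∈ nbhd (⊥ : SimpleGraph N) i, f t j = f t' j) ↔ i ∈ D t) := by
    intro t t' i hi
    have : (∀ j ∈ nbhd (⊥ : SimpleGraph N) i, f t j = f t' j) ↔ f t i = f t' i := by
      simp [nbhd]
    rw [this]
    by_cases h : i ∈ D t
    · simp [f, hi, h]
    · simp [f, hi, h, (huv i).symm]
  have h := le_networkValue_of_weights hpos hk (⊥ : SimpleGraph N) f (privateWeight c B.weight)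
    (by
      rintro (_ | _) (_ | _ | a) <;> simp only [privateWeight]
      · exact zero_le_one
      · exact le_rfl
      · exact le_rfl
      · exact le_rfl
      · linarith
      · exact mul_nonneg hc0 (B.weight_nonneg a))
    (by
      rintro (_ | _)
      · simp [privateWeight, Fintype.sum_option]
      · simp [privateWeight, Fintype.sum_option, ← Finset.mul_sum, B.sum_weight])
    D (Finset.univ.erase (some none))
    (by
      rintro (_ | _ | a) ht _
      · simpa [D] using hkN
      · simp at ht
      · exact B.le_card a)
    (by
      intro t _ i hi
      simp only [viewWeight, hf _ t i hi, Fintype.sum_option]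
      have : ∑ a, (if i ∈ B.set a then c * B.weight a else 0) = c * ((k : ℝ) / Fintype.card N) := by
        rw [← B.marginal i, Finset.mul_sum]
        exact Finset.sum_congr rfl fun a _ => by split_ifs <;> simp
      simp only [D, privateWeight, Finset.mem_univ, if_true, Finset.notMem_empty, if_false, this,
        ite_self, Finset.sum_const_zero, add_zero, zero_add, mul_one]
      exact (prior_mul_successRate_mul hpos hk i).le)
  have e : ∀ ω, ∑ t ∈ Finset.univ.erase (some none), privateWeight c B.weight ω t =
      match ω with
      | State.X => 1
      | State.Y => c := by
    rintro (_ | _)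
    · rw [Finset.sum_erase _ (by simp [privateWeight])]
      simp [privateWeight, Fintype.sum_option]
    · rw [Finset.sum_erase_eq_sub (Finset.mem_univ _)]
      simp [privateWeight, Fintype.sum_option, ← Finset.mul_sum, B.sum_weight]
  rw [e, e] at h
  simp only [mul_one, hc, prior_mul_successRate hpos] at h
  exact h

end PrivateValue

/-! ### Secret sharing on networks with few missing links -/

section ParityExperiment

variable {N : Type*}

/-- The network in which the only missing links are those between `i` and `w i`. -/
def partnerNetwork (w : N → N) : SimpleGraph N where
  Adj i j := i ≠ j ∧ w i ≠ j ∧ w j ≠ i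
  symm := ⟨fun _ _ h => ⟨h.1.symm, h.2.2, h.2.1⟩⟩
  loopless := ⟨fun _ h => h.1 rfl⟩

lemma le_partnerNetwork {g : SimpleGraph N} {w : N → N} (h : ∀ i, ¬ g.Adj i (w i)) :
    g ≤ partnerNetwork w := by
  intro i j hij
  refine ⟨hij.ne, fun e => h i (e ▸ hij), fun e => h j (e ▸ hij.symm)⟩

variable {ι : Type*}

/-- For every `a`, the sum of the shares held by the receivers in `A a`. -/
def parity (A : ι → Finset N) (b : N → ι → ZMod 2) : ι → ZMod 2 := fun a => ∑ j ∈ A a, b j a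

lemma parity_add (A : ι → Finset N) (b b' : N → ι → ZMod 2) :
    parity A (b + b') = parity A b + parity A b' := by
  funext a
  simp [parity, Finset.sum_add_distrib]

variable [DecidableEq ι] [DecidableEq N]

/-- Flipping one share of bit `a` changes that bit and no other. -/
lemma parity_single {A : ι → Finset N} {a : ι} {j : N} (hj : j ∈ A a) :
    parity A (Pi.single j (Pi.single a 1)) = Pi.single a 1 := by
  funext a'
  by_cases h : a' = a
  · subst h
    rw [parity, Finset.sum_eq_single_of_mem j hj]
    · simp
    · intro i _ hi
      simp [Pi.single_eq_of_ne hi]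
  · rw [parity, Pi.single_eq_of_ne h]
    refine Finset.sum_eq_zero fun i _ => ?_
    by_cases hi : i = j
    · subst hi
      simp [Pi.single_eq_of_ne h]
    · simp [Pi.single_eq_of_ne hi]

variable [Fintype ι] [Fintype N]

open Classical in
/-- The number of share profiles in `P` with the given parities. -/
noncomputable def parityCount (A : ι → Finset N) (P : Set (N → ι → ZMod 2)) (z : ι → ZMod 2) : ℝ :=
  ∑ b, if b ∈ P ∧ parity A b = z then 1 else 0

/-- Flipping a share that does not affect membership in `P`. -/
lemma parityCount_single {A : ι → Finset N} {P : Set (N → ι → ZMod 2)} {a : ι} {j : N}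
    (hj : j ∈ A a) (hP : ∀ b, b + Pi.single j (Pi.single a 1) ∈ P ↔ b ∈ P) :
    parityCount A P (Pi.single a 1) = parityCount A P 0 := by
  classical
  rw [parityCount, ← Equiv.sum_comp (Equiv.addRight (Pi.single j (Pi.single a 1)))]
  refine Finset.sum_congr rfl fun b _ => ?_
  simp [hP, parity_add, parity_single hj]

lemma parityCount_univ_pos (A : ι → Finset N) : 0 < parityCount A Set.univ 0 := by
  classical
  refine Finset.sum_pos' (fun b _ => by split_ifs <;> norm_num) ⟨0, Finset.mem_univ _, ?_⟩
  have : parity A 0 = 0 := by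
    funext a
    simp [parity]
  simp [this]

open Classical in
/-- The weights of the parity experiment. In state `X` all parities vanish; in state `Y` exactly
one of them does not, or the state is announced. -/
noncomputable def parityWeight (A : ι → Finset N) (c : ℝ) (p : ι → ℝ) :
    State → Option (N → ι → ZMod 2) → ℝ
  | State.X, none => 0
  | State.X, some b => (if parity A b = 0 then 1 else 0) / parityCount A Set.univ 0
  | State.Y, none => 1 - c
  | State.Y, some b => ∑ a, c * p a * (if parity A b = Pi.single a 1 then 1 else 0) /
      parityCount A Set.univ 0

lemma parityWeight_nonneg (A : ι → Finset N) {c : ℝ} (hc0 : 0 ≤ c) (hc1 : c ≤ 1) {p : ι → ℝ}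
    (hp : ∀ a, 0 ≤ p a) (ω : State) (t : Option (N → ι → ZMod 2)) :
    0 ≤ parityWeight A c p ω t := by
  classical
  have h := (parityCount_univ_pos A).le
  rcases ω with _ | _ <;> rcases t with _ | b
  · exact le_rfl
  · refine div_nonneg ?_ h
    split_ifs <;> norm_num
  · exact sub_nonneg.2 hc1
  · refine Finset.sum_nonneg fun a _ => div_nonneg (mul_nonneg (mul_nonneg hc0 (hp a)) ?_) h
    split_ifs <;> norm_num

open Classical in
lemma sum_parityWeight_X (A : ι → Finset N) (c : ℝ) (p : ι → ℝ) (P : Set (N → ι → ZMod 2)) :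
    ∑ b, (if b ∈ P then parityWeight A c p State.X (some b) else 0) =
      parityCount A P 0 / parityCount A Set.univ 0 := by
  rw [parityCount, Finset.sum_div]
  refine Finset.sum_congr rfl fun b _ => ?_
  by_cases h : b ∈ P <;> simp [h, parityWeight]

open Classical in
lemma sum_parityWeight_Y (A : ι → Finset N) (c : ℝ) (p : ι → ℝ) (P : Set (N → ι → ZMod 2)) :
    ∑ b, (if b ∈ P then parityWeight A c p State.Y (some b) else 0) =
      ∑ a, c * p a * (parityCount A P (Pi.single a 1) / parityCount A Set.univ 0) := by
  have : ∀ b, (if b ∈ P then parityWeight A c p State.Y (some b) else 0) =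
      ∑ a, c * p a * ((if b ∈ P ∧ parity A b = Pi.single a 1 then 1 else 0) /
        parityCount A Set.univ 0) := by
    intro b
    by_cases h : b ∈ P
    · simp only [h, parityWeight, mul_div_assoc, true_and, if_true]
    · simp [h]
  simp_rw [this]
  rw [Finset.sum_comm]
  refine Finset.sum_congr rfl fun a _ => ?_
  rw [← Finset.mul_sum, ← Finset.sum_div]
  rfl

variable {S : N → Type*} [∀ i, Infinite (S i)] {prior : State → ℝ}

/-- On a network whose missing links are those between receivers and their partners, the sender
reaches the private value by sharing the parities among the partners of the receivers to be
persuaded. -/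
theorem le_networkValue_partnerNetwork (hpos : ∀ ω, 0 < prior ω)
    (hsum : prior State.X + prior State.Y = 1) {k : ℕ} (hk : 0 < k) (hkN : k ≤ Fintype.card N)
    (hprior : prior State.X < (k : ℝ) / ((Fintype.card N : ℝ) + (k : ℝ)))
    {w : N → N} (hw : ∀ i, w i ≠ i) (hw3 : ∀ i, w (w (w i)) = w i)
    (B : BalancedFamily N k ι) (hB : ∀ a i j, w i = w j → i ∈ B.set a → j ∈ B.set a) :
    prior State.X + Fintype.card N * prior State.X / k ≤
      networkValue S prior k (partnerNetwork w) := by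
  classical
  set c := successRate N prior k with hc
  have hc0 : 0 ≤ c := successRate_nonneg hpos k
  have hc1 : c ≤ 1 := successRate_le_one hpos hsum hk hprior
  let A : ι → Finset N := fun a => (B.set a).image w
  have hA : ∀ a i, i ∈ B.set a → w i ∈ A a := fun a i hi => Finset.mem_image_of_mem w hi
  have hblind : ∀ i, w i ∉ nbhd (partnerNetwork w) i := by
    rintro i (h | h)
    · exact h.2.1 rfl
    · exact hw i h
  -- The share of w l could be hidden from i only if w i = w l or w (w l) = i. By w³ = w the second
  -- case implies the first, and then i shares the fiber of l and belongs to the set.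
  have hsee : ∀ a i, i ∉ B.set a → ∀ j ∈ A a, j ∈ nbhd (partnerNetwork w) i := by
    intro a i hi j hj
    obtain ⟨l, hl, rfl⟩ := Finset.mem_image.1 hj
    by_cases hij : w l = i
    · exact Or.inr hij
    · refine Or.inl ⟨Ne.symm hij, fun h => hi (hB a l i h.symm hl), fun h => ?_⟩
      exact hi (hB a l i (by rw [← h, hw3]) hl)
  let enc : ∀ j, Option (ι → ZMod 2) ↪ S j := fun j =>
    (Fintype.equivFin (Option (ι → ZMod 2))).toEmbedding.trans
      (Fin.valEmbedding.trans (Infinite.natEmbedding (S j)))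
  let f : Option (N → ι → ZMod 2) → Signal S := fun t j => enc j (t.map fun b => b j)
  -- All parity classes in use have equal size, so one normalizing constant serves both states.
  have hpc : ∀ a, parityCount A Set.univ (Pi.single a 1) = parityCount A Set.univ 0 := by
    intro a
    obtain ⟨i, hi⟩ := Finset.card_pos.1 (hk.trans_le (B.le_card a))
    exact parityCount_single (hA a i hi) fun b => by simp
  have hZ := parityCount_univ_pos A
  have hX1 : ∑ b, parityWeight A c B.weight State.X (some b) = 1 := by
    have := sum_parityWeight_X A c B.weight Set.univ
    simp only [Set.mem_univ, if_true] at this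
    rw [this, div_self hZ.ne']
  have hY1 : ∑ b, parityWeight A c B.weight State.Y (some b) = c := by
    have := sum_parityWeight_Y A c B.weight Set.univ
    simp only [Set.mem_univ, if_true] at this
    simp only [this, hpc, div_self hZ.ne', mul_one]
    rw [← Finset.mul_sum, B.sum_weight, mul_one]
  let D : Option (N → ι → ZMod 2) → Finset N
    | none => ∅
    -- The receivers that detect no flipped bit.
    | some b => Finset.univ.filter fun i => ∀ a, i ∉ B.set a → parity A b a = 0
  obtain ⟨P, hP⟩ : ∃ P : N → (N → ι → ZMod 2) → Set (N → ι → ZMod 2), ∀ i b b',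
      b' ∈ P i b ↔ ∀ j ∈ nbhd (partnerNetwork w) i, b' j = b j :=
    ⟨fun i b => {b' | ∀ j ∈ nbhd (partnerNetwork w) i, b' j = b j}, fun _ _ _ => Iff.rfl⟩
  have hview : ∀ ω i b, viewWeight (partnerNetwork w) f (parityWeight A c B.weight ω) i (some b) =
      ∑ b', if b' ∈ P i b then parityWeight A c B.weight ω (some b') else 0 := by
    intro ω i b
    have h0 : ¬ ∀ j ∈ nbhd (partnerNetwork w) i, f none j = f (some b) j := by
      intro h
      have := (enc i).injective (h i (Or.inr rfl))
      simp at this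
    have h1 : ∀ b', (∀ j ∈ nbhd (partnerNetwork w) i, f (some b') j = f (some b) j) ↔
        b' ∈ P i b := by
      intro b'
      simp [f, hP]
    rw [viewWeight, Fintype.sum_option, if_neg h0, zero_add]
    exact Finset.sum_congr rfl fun b' _ => by simp only [h1]
  have h := le_networkValue_of_weights hpos hk (partnerNetwork w) f (parityWeight A c B.weight)
    (parityWeight_nonneg A hc0 hc1 B.weight_nonneg)
    (by
      rintro (_ | _)
      · rw [Fintype.sum_option, hX1]
        simp [parityWeight]
      · rw [Fintype.sum_option, hY1]
        simp [parityWeight])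
    D (Finset.univ.map Function.Embedding.some)
    (by
      intro t ht hω
      obtain ⟨b, -, rfl⟩ := Finset.mem_map.1 ht
      have hcases : parity A b = 0 ∨ ∃ a, parity A b = Pi.single a 1 := by
        by_contra hcon
        push Not at hcon
        obtain ⟨ω, hω⟩ := hω
        cases ω <;> simp [parityWeight, hcon] at hω
      rcases hcases with h | ⟨a, h⟩
      · have : D (some b) = Finset.univ := by
          ext i
          simp [D, h]
        exact this ▸ hkN
      · refine (B.le_card a).trans (Finset.card_le_card fun i hi => ?_)
        refine Finset.mem_filter.2 ⟨Finset.mem_univ i, fun a' ha' => ?_⟩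
        rw [h, Pi.single_eq_of_ne]
        rintro rfl
        exact ha' hi)
    (by
      intro t ht i hi
      obtain ⟨b, -, rfl⟩ := Finset.mem_map.1 ht
      have hi' : ∀ a, i ∉ B.set a → parity A b a = 0 := (Finset.mem_filter.1 hi).2
      change prior State.Y * viewWeight _ f _ i (some b) ≤
        prior State.X * viewWeight _ f _ i (some b)
      rw [hview, hview, sum_parityWeight_X, sum_parityWeight_Y]
      -- For a set containing i, flipping the unseen share of w i shows that bit 0 and bit 1 are
      -- equally compatible with its view. For other sets i sees that the bit is 0. Only the
      -- marginal k/n of i survives in the sum.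
      have hcount : ∀ a, c * B.weight a *
          (parityCount A (P i b) (Pi.single a 1) / parityCount A Set.univ 0) =
          c * (parityCount A (P i b) 0 / parityCount A Set.univ 0) *
            (if i ∈ B.set a then B.weight a else 0) := by
        intro a
        by_cases hia : i ∈ B.set a
        · rw [if_pos hia, parityCount_single (hA a i hia)]
          · ring
          · intro b'
            rw [hP, hP]
            refine forall₂_congr fun j hj => ?_
            have : j ≠ w i := fun h => hblind i (h ▸ hj)
            simp [Pi.single_eq_of_ne this]
        · have : parityCount A (P i b) (Pi.single a 1) = 0 := by
            refine Finset.sum_eq_zero fun b' _ => if_neg fun h => ?_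
            have h1 : parity A b' a = parity A b a :=
              Finset.sum_congr rfl fun j hj => by rw [(hP i b b').1 h.1 j (hsee a i hia j hj)]
            rw [h.2, hi' a hia, Pi.single_eq_same] at h1
            exact one_ne_zero h1
          rw [if_neg hia, this]
          ring
      rw [Finset.sum_congr rfl fun a _ => hcount a, ← Finset.mul_sum, B.marginal]
      refine le_of_eq ?_
      rw [← prior_mul_successRate_mul hpos hk i]
      ring)
  rw [Finset.sum_map, Finset.sum_map] at h
  simp only [Function.Embedding.some_apply, hX1, hY1, mul_one] at h
  rw [hc, prior_mul_successRate hpos] at h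
  exact h

end ParityExperiment

/-! ### Halos as wheels, and partner functions -/

section Halo

lemma val_finRotate {m : ℕ} (i : Fin m) :
    ((finRotate m i : Fin m) : ℕ) = if (i : ℕ) + 1 = m then 0 else (i : ℕ) + 1 := by
  obtain _ | m := m
  · exact i.elim0
  · rw [finRotate_apply, Fin.val_add_one]
    simp [Fin.ext_iff]

/-- A halo on more than three receivers is a wheel: the center is linked to everyone, and there are
no chords. -/
lemma IsHalo.wheel {V : Type*} [Finite V] {H : SimpleGraph V} (h : IsHalo H)
    (hV : 3 ≤ Nat.card V) :
    ∃ (m : ℕ) (c : Fin m → V) (r : V), 3 ≤ m ∧ Nat.card V = m + 1 ∧ Function.Injective c ∧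
      (∀ i, c i ≠ r) ∧ (∀ i, H.Adj r (c i)) ∧
      ∀ i j, H.Adj (c i) (c j) → finRotate m i = j ∨ finRotate m j = i := by
  classical
  have := Fintype.ofFinite V
  obtain ⟨m, c, r, hcard, hedge, hinj, hcr, hrot, hdeg⟩ := h
  have hm : 3 ≤ m := by
    by_contra hm
    have hm2 : m = 2 := by omega
    subst hm2
    -- For m = 2 a halo would need four links on three receivers.
    have h1 := H.card_edgeFinset_le_card_choose_two
    rw [← Nat.card_eq_fintype_card, hcard, ← SimpleGraph.coe_edgeFinset, Set.ncard_coe_finset] at *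
    rw [hedge] at h1
    norm_num [Nat.choose] at h1
  have hrange : Set.range c = {r}ᶜ := by
    refine Set.eq_of_subset_of_ncard_le ?_ ?_ (Set.toFinite _)
    · rintro _ ⟨i, rfl⟩
      exact hcr i
    · have h1 := Set.ncard_add_ncard_compl ({r} : Set V)
      rw [Set.ncard_singleton, hcard] at h1
      rw [Set.ncard_range_of_injective hinj, Nat.card_eq_fintype_card, Fintype.card_fin]
      omega
  have hspoke : ∀ i, H.Adj r (c i) := by
    have : H.neighborSet r = Set.range c := by
      refine Set.eq_of_subset_of_ncard_le ?_ ?_ (Set.toFinite _)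
      · intro v hv
        rw [hrange]
        exact (SimpleGraph.Adj.ne hv).symm
      · rw [hdeg, Set.ncard_range_of_injective hinj, Nat.card_eq_fintype_card, Fintype.card_fin]
    intro i
    have hi : c i ∈ H.neighborSet r := this ▸ Set.mem_range_self i
    exact hi
  refine ⟨m, c, r, hm, hcard, hinj, hcr, hspoke, fun i j hij => ?_⟩
  by_contra hcon
  push Not at hcon
  -- Spokes and rim already account for all 2m links; a chord would give 2m + 1 distinct ones. Rim
  -- links are distinct because m ≥ 3.
  let F : Fin m ⊕ Fin m ⊕ Unit → H.edgeSet
    | Sum.inl a => ⟨s(r, c a), hspoke a⟩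
    | Sum.inr (Sum.inl a) => ⟨s(c a, c (finRotate m a)), hrot a⟩
    | Sum.inr (Sum.inr _) => ⟨s(c i, c j), hij⟩
  have hF : Function.Injective F := by
    have hrot2 : ∀ a b : Fin m, a = finRotate m b → finRotate m a = b → False := by
      rintro a b rfl h2
      have h3 := congrArg Fin.val h2
      rw [val_finRotate, val_finRotate] at h3
      have := b.isLt
      split_ifs at h3 <;> omega
    rintro (a | a | a) (b | b | b) hab
    all_goals
      replace hab := congrArg Subtype.val hab
      simp only [F, Sym2.eq_iff, hinj.eq_iff, hcr, (hcr _).symm,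
      false_and, and_false, or_false, true_and] at hab
    · rw [hab]
    · rcases hab with h | h
      · rw [h.1]
      · exact (hrot2 a b h.1 h.2).elim
    · rcases hab with ⟨rfl, h⟩ | ⟨rfl, h⟩
      · exact (hcon.1 h).elim
      · exact (hcon.2 h).elim
    · rcases hab with ⟨rfl, h⟩ | ⟨h, rfl⟩
      · exact (hcon.1 h.symm).elim
      · exact (hcon.2 h.symm).elim
    · rfl
  have hle := Nat.card_le_card_of_injective F hF
  rw [Nat.card_coe_set_eq, hedge, Nat.card_eq_fintype_card] at hle
  simp at hle
  omega

/-- The partner function on the positions of a network with a halo. The positions below `m` form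
the rim of the halo in cyclic order, `m` is the center, and the later `d` positions are outside.
The first `l` rim positions are matched with rim positions at distance `s`, and the other positions
of the halo with the outside. -/
def haloPartner (m d s l i : ℕ) : ℕ :=
  if i < l then i + s
  else if i < s then m + 1 + (i - l)
  else if i < s + l then i - s
  else if i ≤ m then m + 1 + min (i - 2 * l) (d - 1)
  else if i - m - 1 < s - l then i - m - 1 + l
  else i - m - 1 + 2 * l

/-- A disjunction of linear facts, with the minimum resolved, so that `omega` can treat iterates of
the function as opaque numbers. -/
lemma haloPartner_spec (m d s l i : ℕ) :
    (i < l ∧ haloPartner m d s l i = i + s) ∨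
    (l ≤ i ∧ i < s ∧ haloPartner m d s l i = m + 1 + (i - l)) ∨
    (l ≤ i ∧ s ≤ i ∧ i < s + l ∧ haloPartner m d s l i = i - s) ∨
    (l ≤ i ∧ s + l ≤ i ∧ i ≤ m ∧ i - 2 * l ≤ d - 1 ∧
      haloPartner m d s l i = m + 1 + (i - 2 * l)) ∨
    (l ≤ i ∧ s + l ≤ i ∧ i ≤ m ∧ d - 1 < i - 2 * l ∧
      haloPartner m d s l i = m + 1 + (d - 1)) ∨
    (l ≤ i ∧ s + l ≤ i ∧ m < i ∧ i - m - 1 < s - l ∧ haloPartner m d s l i = i - m - 1 + l) ∨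
    (l ≤ i ∧ s + l ≤ i ∧ m < i ∧ s - l ≤ i - m - 1 ∧
      haloPartner m d s l i = i - m - 1 + 2 * l) := by
  unfold haloPartner
  split_ifs with h1 h2 h3 h4 h5
  · exact Or.inl ⟨h1, rfl⟩
  · exact Or.inr (Or.inl ⟨not_lt.1 h1, h2, rfl⟩)
  · exact Or.inr (Or.inr (Or.inl ⟨not_lt.1 h1, not_lt.1 h2, h3, rfl⟩))
  · refine Or.inr (Or.inr (Or.inr ?_))
    rcases le_or_gt (i - 2 * l) (d - 1) with h | h
    · exact Or.inl ⟨not_lt.1 h1, not_lt.1 h3, h4, h, by rw [min_eq_left h]⟩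
    · exact Or.inr (Or.inl ⟨not_lt.1 h1, not_lt.1 h3, h4, h, by rw [min_eq_right h.le]⟩)
  · exact Or.inr (Or.inr (Or.inr (Or.inr (Or.inr (Or.inl
      ⟨not_lt.1 h1, not_lt.1 h3, not_le.1 h4, h5, rfl⟩)))))
  · exact Or.inr (Or.inr (Or.inr (Or.inr (Or.inr (Or.inr
      ⟨not_lt.1 h1, not_lt.1 h3, not_le.1 h4, not_lt.1 h5, rfl⟩)))))

/-- A partner function on positions that links no rim position to itself or its rim neighbors and
whose fibers are respected by a balanced family of receivers. -/
def IsGoodPartner (m d k : ℕ) (w : Fin (m + 1 + d) → Fin (m + 1 + d)) : Prop :=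
  (∀ i, w i ≠ i) ∧ (∀ i, w (w (w i)) = w i) ∧
  (∀ i, (i.val < m ∧ (w i).val < m ∧
      ((i.val + 2 ≤ (w i).val ∧ (w i).val + 2 ≤ i.val + m) ∨
        ((w i).val + 2 ≤ i.val ∧ i.val + 2 ≤ (w i).val + m))) ∨
    (i.val ≤ m ∧ m < (w i).val) ∨ (m < i.val ∧ (w i).val ≤ m)) ∧
  ∃ (ι : Type) (_ : Fintype ι) (_ : DecidableEq ι) (B : BalancedFamily (Fin (m + 1 + d)) k ι),
    ∀ a i j, w i = w j → i ∈ B.set a → j ∈ B.set a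

/-- The bijection that puts a pair of positions at `m - 1` and `m`. -/
lemma exists_equiv_pair (m d : ℕ) (hm : 1 ≤ m) :
    ∃ e : Fin (m - 1 + d) ⊕ Fin 2 ≃ Fin (m + 1 + d),
      ∀ i : Fin (m + 1 + d), ((i : ℕ) = m - 1 ∨ (i : ℕ) = m) → ∃ s, e (Sum.inr s) = i := by
  let f : Fin (m - 1 + d) ⊕ Fin 2 → Fin (m + 1 + d) := Sum.elim
    (fun t => ⟨if (t : ℕ) < m - 1 then t else t + 2, by have := t.isLt; split_ifs <;> omega⟩)
    (fun s => ⟨m - 1 + s, by have := s.isLt; omega⟩)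
  have hf : Function.Injective f := by
    rintro (a | a) (b | b) h
    all_goals
      have h' := congrArg Fin.val h
      have := a.isLt
      have := b.isLt
      simp only [f, Sum.elim_inl, Sum.elim_inr] at h'
    · congr 1
      ext
      split_ifs at h' <;> omega
    · split_ifs at h' <;> omega
    · split_ifs at h' <;> omega
    · congr 1
      ext
      omega
  have hbij : Function.Bijective f := by
    rw [Fintype.bijective_iff_injective_and_card]
    refine ⟨hf, ?_⟩
    simp
    omega
  refine ⟨Equiv.ofBijective f hbij, ?_⟩
  rintro i (hi | hi)
  · exact ⟨0, Fin.ext (by simp [f, hi])⟩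
  · exact ⟨1, Fin.ext (by simp [f, hi]; omega)⟩

lemma BalancedFamily.mem_paired {m k : ℕ} [NeZero m] (hk2 : 2 ≤ k) (hkm : k ≤ m)
    (a : Fin m ⊕ Fin m) (s t : Fin 2)
    (h : Sum.inr s ∈ (BalancedFamily.paired hk2 hkm).set a) :
    Sum.inr t ∈ (BalancedFamily.paired hk2 hkm).set a := by
  rcases a with a | a
  · simp [BalancedFamily.paired]
  · simp [BalancedFamily.paired] at h

/-- For m ≥ 4 positions half a turn apart on the rim are not rim neighbors. Enough such pairs are
formed to leave d or d + 1 halo positions for the d outsiders. -/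
lemma exists_isGoodPartner {m d k : ℕ} (hm : 4 ≤ m) (hd : 1 ≤ d) (hdm : d < m) (hk2 : 2 ≤ k)
    (hkm : k ≤ m) : ∃ w, IsGoodPartner m d k w := by
  obtain ⟨s, hs1, hs2⟩ : ∃ s, 2 * s ≤ m ∧ m ≤ 2 * s + 1 := ⟨m / 2, by omega, by omega⟩
  obtain ⟨l, hl1, hl2⟩ : ∃ l, d + 2 * l ≤ m + 1 ∧ m ≤ d + 2 * l :=
    ⟨(m + 1 - d) / 2, by omega, by omega⟩
  have hlt : ∀ i < m + 1 + d, haloPartner m d s l i < m + 1 + d := by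
    intro i hi
    rcases haloPartner_spec m d s l i with h1 | h1 | h1 | h1 | h1 | h1 | h1 <;> omega
  refine ⟨fun i => ⟨haloPartner m d s l i, hlt i i.isLt⟩, ?_, ?_, ?_, ?_⟩
  · intro i h
    have h := congrArg Fin.val h
    have := haloPartner_spec m d s l i
    simp only at h
    rcases this with h1 | h1 | h1 | h1 | h1 | h1 | h1 <;> omega
  · intro i
    have hi := i.isLt
    ext
    simp only
    generalize (i : ℕ) = i at hi
    have h1 := haloPartner_spec m d s l i
    have h2 := haloPartner_spec m d s l (haloPartner m d s l i)
    have h3 := haloPartner_spec m d s l (haloPartner m d s l (haloPartner m d s l i))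
    generalize haloPartner m d s l (haloPartner m d s l (haloPartner m d s l i)) = x at *
    generalize haloPartner m d s l (haloPartner m d s l i) = y at *
    generalize haloPartner m d s l i = z at *
    rcases h1 with h1 | h1 | h1 | h1 | h1 | h1 | h1 <;>
    rcases h2 with h2 | h2 | h2 | h2 | h2 | h2 | h2 <;> omega
  · intro i
    have hi := i.isLt
    simp only
    rcases haloPartner_spec m d s l i with h1 | h1 | h1 | h1 | h1 | h1 | h1 <;> omega
  -- If the numbers match, w is injective and any balanced family works. Otherwise positions m - 1
  -- and m share the last outsider as partner, and the family must keep them together.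
  · by_cases hpar : d + 2 * l = m + 1
    · have : NeZero (m + 1 + d) := ⟨by omega⟩
      refine ⟨_, inferInstance, inferInstance,
        BalancedFamily.cyclic (show k ≤ m + 1 + d by omega), fun a i j hij hi => ?_⟩
      have : i = j := by
        have h := congrArg Fin.val hij
        have h1 := haloPartner_spec m d s l i
        have h2 := haloPartner_spec m d s l j
        have := i.isLt
        have := j.isLt
        simp only at h
        ext
        rw [h] at h1
        generalize haloPartner m d s l j = z at *
        rcases h1 with h1 | h1 | h1 | h1 | h1 | h1 | h1 <;> omega
      exact this ▸ hi
    · have : NeZero (m - 1 + d) := ⟨by omega⟩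
      obtain ⟨e, he⟩ := exists_equiv_pair m d (by omega)
      refine ⟨_, inferInstance, inferInstance,
        (BalancedFamily.paired hk2 (show k ≤ m - 1 + d by omega)).map e, fun a i j hij hi => ?_⟩
      have : i = j ∨ (((i : ℕ) = m - 1 ∨ (i : ℕ) = m) ∧ ((j : ℕ) = m - 1 ∨ (j : ℕ) = m)) := by
        have h := congrArg Fin.val hij
        have h1 := haloPartner_spec m d s l i
        have h2 := haloPartner_spec m d s l j
        have := i.isLt
        have := j.isLt
        simp only at h
        rw [Fin.ext_iff]
        rw [h] at h1
        generalize haloPartner m d s l j = z at *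
        rcases h1 with h1 | h1 | h1 | h1 | h1 | h1 | h1 <;> omega
      rcases this with rfl | ⟨h1, h2⟩
      · exact hi
      · obtain ⟨s1, rfl⟩ := he i h1
        obtain ⟨s2, rfl⟩ := he j h2
        simp only [BalancedFamily.map, Finset.mem_map_equiv, Equiv.symm_apply_apply] at hi ⊢
        exact BalancedFamily.mem_paired hk2 _ a s1 s2 hi

/-- The complete network on four receivers with two further receivers. -/
lemma exists_isGoodPartner_three : ∃ w, IsGoodPartner 3 2 3 w := by
  -- The nontrivial fibers are {0, 1} and {2, 3}; each half of the partition below keeps one of them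
  -- and adds one outsider.
  refine ⟨![4, 4, 5, 5, 0, 2], by decide, by decide, by decide, Fin 2, inferInstance, inferInstance,
    { weight := fun _ => 1 / 2
      set := ![{0, 1, 5}, {2, 3, 4}]
      weight_nonneg := fun _ => by norm_num
      sum_weight := by norm_num
      le_card := by decide
      marginal := fun i => by
        fin_cases i <;> simp [Fin.sum_univ_two] <;> norm_num }, by decide⟩

end Halo

/-! ### Transport to the given network and conclusion -/

section MainTheorem

/-- The receivers of a network with a halo component, enumerated along the rim, the center and the
outside. -/
lemma exists_halo_enumeration {V : Type*} [Finite V] {g : SimpleGraph V}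
    (C : g.ConnectedComponent) (hC : IsHalo C.toSimpleGraph) (hV : 3 ≤ C.supp.ncard) :
    ∃ (m d : ℕ) (e : Fin (m + 1 + d) ≃ V), 3 ≤ m ∧ C.supp.ncard = m + 1 ∧
      (∀ i, e i ∈ C.supp ↔ i.val ≤ m) ∧
      (∀ i j, i.val = m → j.val < m → g.Adj (e i) (e j)) ∧
      (∀ i j, i.val < m → j.val < m → g.Adj (e i) (e j) →
        (j.val = if i.val + 1 = m then 0 else i.val + 1) ∨
        (i.val = if j.val + 1 = m then 0 else j.val + 1)) := by
  classical
  have := Fintype.ofFinite V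
  obtain ⟨m, c, r, hm, hcard, hinj, hcr, hspoke, hchord⟩ :=
    hC.wheel (by rwa [← Nat.card_coe_set_eq] at hV)
  have hncard : C.supp.ncard = m + 1 := hcard
  let o := (Finite.equivFin (C.suppᶜ : Set V)).symm
  set d := Nat.card (C.suppᶜ : Set V) with hd
  have hsum : m + 1 + d = Nat.card V := by
    rw [← hncard, hd, Nat.card_coe_set_eq, Set.ncard_add_ncard_compl]
  let f : Fin (m + 1 + d) → V := fun i =>
    if h : i.val < m then (c ⟨i, h⟩).1
    else if h2 : i.val ≤ m then r.1
    else (o ⟨i.val - m - 1, by have := i.isLt; omega⟩).1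
  have hf1 : ∀ i (h : i.val < m), f i = (c ⟨i, h⟩).1 := fun i h => dif_pos h
  have hf2 : ∀ i, i.val = m → f i = r.1 := fun i h => by simp [f, h]
  have hf3 : ∀ i (h : m < i.val), f i = (o ⟨i.val - m - 1, by have := i.isLt; omega⟩).1 :=
    fun i h => by
      have h1 : ¬ i.val < m := by omega
      have h2 : ¬ i.val ≤ m := by omega
      simp [f, h1, h2]
  have hmem : ∀ i, f i ∈ C.supp ↔ i.val ≤ m := by
    intro i
    rcases lt_trichotomy i.val m with h | h | h
    · rw [hf1 i h]
      exact iff_of_true (c _).2 h.le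
    · rw [hf2 i h]
      exact iff_of_true r.2 h.le
    · rw [hf3 i h]
      exact iff_of_false (o _).2 (not_le.2 h)
  have hfinj : Function.Injective f := by
    intro i j hij
    have hiff : i.val ≤ m ↔ j.val ≤ m := by rw [← hmem, ← hmem, hij]
    rcases lt_trichotomy i.val m with h | h | h <;> rcases lt_trichotomy j.val m with h' | h' | h'
    · rw [hf1 i h, hf1 j h'] at hij
      exact Fin.ext (congrArg Fin.val (hinj (Subtype.ext hij)) :)
    · rw [hf1 i h, hf2 j h'] at hij
      exact (hcr _ (Subtype.ext hij)).elim
    · omega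
    · rw [hf2 i h, hf1 j h'] at hij
      exact (hcr _ (Subtype.ext hij.symm)).elim
    · exact Fin.ext (h.trans h'.symm)
    · omega
    · omega
    · omega
    · rw [hf3 i h, hf3 j h'] at hij
      have := congrArg Fin.val (o.injective (Subtype.ext hij))
      simp only at this
      exact Fin.ext (by omega)
  have hbij : Function.Bijective f := by
    rw [Fintype.bijective_iff_injective_and_card]
    exact ⟨hfinj, by rw [Fintype.card_fin, hsum, Nat.card_eq_fintype_card]⟩
  refine ⟨m, d, Equiv.ofBijective f hbij, hm, hncard, hmem, fun i j hi hj => ?_,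
    fun i j hi hj hij => ?_⟩
  · simp only [Equiv.ofBijective_apply]
    rw [hf2 i hi, hf1 j hj]
    exact hspoke _
  · simp only [Equiv.ofBijective_apply] at hij
    rw [hf1 i hi, hf1 j hj] at hij
    rcases hchord ⟨i, hi⟩ ⟨j, hj⟩ hij with h | h
    · left
      rw [← val_finRotate ⟨i, hi⟩, h]
    · right
      rw [← val_finRotate ⟨j, hj⟩, h]

/-- Every partner function on positions of a network with a halo gives missing links. -/
lemma IsGoodPartner.exists_partner {V : Type*} [Fintype V] [DecidableEq V] {g : SimpleGraph V}
    {C : g.ConnectedComponent} {m d k : ℕ} {w : Fin (m + 1 + d) → Fin (m + 1 + d)}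
    (hw : IsGoodPartner m d k w) (e : Fin (m + 1 + d) ≃ V)
    (hmem : ∀ i, e i ∈ C.supp ↔ i.val ≤ m)
    (hchord : ∀ i j, i.val < m → j.val < m → g.Adj (e i) (e j) →
        (j.val = if i.val + 1 = m then 0 else i.val + 1) ∨
        (i.val = if j.val + 1 = m then 0 else j.val + 1)) :
    ∃ w' : V → V, (∀ v, w' v ≠ v) ∧ (∀ v, w' (w' (w' v)) = w' v) ∧ (∀ v, ¬ g.Adj v (w' v)) ∧
      ∃ (ι : Type) (_ : Fintype ι) (_ : DecidableEq ι) (B : BalancedFamily V k ι),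
        ∀ a u v, w' u = w' v → u ∈ B.set a → v ∈ B.set a := by
  obtain ⟨hw1, hw3, hfar, ι, _, _, B, hB⟩ := hw
  have hcomp : ∀ i j, g.Adj (e i) (e j) → (i.val ≤ m ↔ j.val ≤ m) := by
    intro i j hij
    rw [← hmem, ← hmem]
    exact C.mem_supp_congr_adj hij
  refine ⟨fun v => e (w (e.symm v)), fun v h => ?_, fun v => ?_, fun v h => ?_,
    ι, inferInstance, inferInstance, B.map e, fun a u v huv hu => ?_⟩
  · exact hw1 (e.symm v) ((Equiv.eq_symm_apply e).2 h)
  · simp [hw3]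
  · obtain ⟨i, rfl⟩ := e.surjective v
    simp only [Equiv.symm_apply_apply] at h
    have h1 := hcomp _ _ h
    rcases hfar i with ⟨hi, hwi, hf⟩ | hf | hf
    · have := hchord _ _ hi hwi h
      split_ifs at this <;> omega
    · omega
    · omega
  · simp only [BalancedFamily.map, Finset.mem_map_equiv] at hu ⊢
    exact hB a _ _ (e.injective huv) hu

lemma networkValue_le {N : Type*} [Fintype N] {S : N → Type*} {prior : State → ℝ}
    (hpos : ∀ ω, 0 < prior ω) {k : ℕ} (hk : 0 < k) (g : SimpleGraph N) :
    networkValue S prior k g ≤ prior State.X + Fintype.card N * prior State.X / k := by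
  have := hpos State.X
  -- The bound must be nonnegative because a real supremum over an empty type is 0.
  exact Real.iSup_le (fun π => experimentValue_le hpos hk g π) (by positivity)

/-- The value of a network in which some receiver observes everything that more than `k` receivers
observe is smaller than the private value. -/
lemma networkValue_lt_of_nbhd_subset {N : Type*} [Fintype N] {S : N → Type*} {prior : State → ℝ}
    (hpos : ∀ ω, 0 < prior ω) {k : ℕ} (hk : 0 < k) (g : SimpleGraph N) {C : Set N} {r : N}
    (hr : r ∈ C) (hkC : k < C.ncard) (hC : ∀ i ∈ C, nbhd g i ⊆ nbhd g r) :
    networkValue S prior k g < prior State.X + Fintype.card N * prior State.X / k := by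
  have hX := hpos State.X
  have hk' : (0 : ℝ) < k := by exact_mod_cast hk
  have : Nonempty N := ⟨r⟩
  have hN : (1 : ℝ) ≤ Fintype.card N := by exact_mod_cast Fintype.card_pos
  have h0 : 0 ≤ ((Fintype.card N : ℝ) - 1) * prior State.X / k :=
    div_nonneg (mul_nonneg (by linarith) hX.le) hk'.le
  refine (Real.iSup_le (fun π => experimentValue_le_of_nbhd_subset hpos hk g π hr hkC hC)
    (by linarith)).trans_lt ?_
  gcongr
  linarith

/-- The center of a halo component observes the whole component. -/
lemma nbhd_subset_nbhd_center {V : Type*} {g : SimpleGraph V} {C : g.ConnectedComponent} {r : V}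
    (hr : ∀ v ∈ C.supp, v ≠ r → g.Adj r v) : ∀ i ∈ C.supp, nbhd g i ⊆ nbhd g r := by
  intro i hi j hj
  have hjC : j ∈ C.supp := by
    rcases hj with h | rfl
    · exact (C.mem_supp_congr_adj h).1 hi
    · exact hi
  by_cases hjr : j = r
  · exact Or.inr hjr
  · exact Or.inl (hr j hjC hjr)

/-- An extension of a network with a large halo component attains the private value. -/
theorem exists_extension_of_isHalo {n k : ℕ} (S : Fin n → Type*) [∀ i, Infinite (S i)]
    (prior : State → ℝ) (hpos : ∀ ω, 0 < prior ω) (hsum : prior State.X + prior State.Y = 1)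
    (hk : (n + 1) / 2 ≤ k) (hprior : prior State.X < (k : ℝ) / ((n : ℝ) + (k : ℝ)))
    (g : SimpleGraph (Fin n)) (C : g.ConnectedComponent) (hC : IsHalo C.toSimpleGraph)
    (hkC : k < C.supp.ncard) (hCn : C.supp.ncard < n) (hexc : ¬ (C.supp.ncard = 4 ∧ n = 5)) :
    ∃ g' : SimpleGraph (Fin n), g < g' ∧ networkValue S prior k g < networkValue S prior k g' ∧
      networkValue S prior k g' = privateValue S prior k := by
  have : NeZero n := ⟨by omega⟩
  have hk0 : 0 < k := by omega
  have hkn : k ≤ n := by omega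
  have hprior' : prior State.X < (k : ℝ) / ((Fintype.card (Fin n) : ℝ) + (k : ℝ)) := by
    rwa [Fintype.card_fin]
  have hkn' : k ≤ Fintype.card (Fin n) := by rwa [Fintype.card_fin]
  have hprivate : privateValue S prior k =
      prior State.X + Fintype.card (Fin n) * prior State.X / k :=
    le_antisymm (networkValue_le hpos hk0 ⊥)
      (le_networkValue_bot hpos hsum hk0 hkn' hprior' (BalancedFamily.cyclic hkn))
  obtain ⟨m, d, e, hm, hCm, hmem, hspoke, hchord⟩ := exists_halo_enumeration C hC (by omega)
  have hn : m + 1 + d = n := by simpa using Fintype.card_congr e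
  have hw : ∃ w, IsGoodPartner m d k w := by
    -- From ⌊(n+1)/2⌋ ≤ k ≤ m and n = m + 1 + d follows d < m. For m = 3 the excluded case rules out
    -- d = 1, so d = 2 and k = 3.
    rcases hm.eq_or_lt with rfl | hm
    · obtain rfl : d = 2 := by omega
      obtain rfl : k = 3 := by omega
      exact exists_isGoodPartner_three
    · exact exists_isGoodPartner hm (by omega) (by omega) (by omega) (by omega)
  obtain ⟨w, hw⟩ := hw
  obtain ⟨w', hw1, hw3, hadj, ι, _, _, B, hB⟩ := hw.exists_partner e hmem hchord
  have hlt : networkValue S prior k g <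
      prior State.X + Fintype.card (Fin n) * prior State.X / k := by
    let r : Fin (m + 1 + d) := ⟨m, by omega⟩
    refine networkValue_lt_of_nbhd_subset hpos hk0 g ((hmem r).2 le_rfl) hkC
      (nbhd_subset_nbhd_center fun v hv hvr => ?_)
    obtain ⟨i, rfl⟩ := e.surjective v
    refine hspoke r i rfl (lt_of_le_of_ne ((hmem i).1 hv) fun h => hvr ?_)
    rw [show i = r from Fin.ext h]
  have hval : networkValue S prior k (partnerNetwork w') =
      prior State.X + Fintype.card (Fin n) * prior State.X / k :=
    le_antisymm (networkValue_le hpos hk0 _)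
      (le_networkValue_partnerNetwork hpos hsum hk0 hkn' hprior' hw1 hw3 B hB)
  refine ⟨partnerNetwork w', lt_of_le_of_ne (le_partnerNetwork hadj) ?_, hval ▸ hlt,
    hval.trans hprivate.symm⟩
  rintro h
  rw [← h] at hval
  exact hlt.ne hval

end MainTheorem

end NetworkPersuasion

theorem mainTheorem6 (n k : ℕ) (S : Fin n → Type*) [∀ i, Countable (S i)] [∀ i, Infinite (S i)]
    (prior : NetworkPersuasion.State → ℝ)
    (hprior_pos : ∀ ω, 0 < prior ω)
    (hprior_sum : prior NetworkPersuasion.State.X + prior NetworkPersuasion.State.Y = 1)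
    (hk : (n + 1) / 2 ≤ k)
    (hprior : prior NetworkPersuasion.State.X < (k : ℝ) / ((n : ℝ) + (k : ℝ)))
    (g : SimpleGraph (Fin n)) (C : g.ConnectedComponent)
    (hC : NetworkPersuasion.IsHalo C.toSimpleGraph)
    (hkC : k < C.supp.ncard) (hCn : C.supp.ncard < n)
    (hexc : ¬ (C.supp.ncard = 4 ∧ n = 5)) :
    ∃ g' : SimpleGraph (Fin n), g < g' ∧
      NetworkPersuasion.networkValue S prior k g < NetworkPersuasion.networkValue S prior k g' ∧
      NetworkPersuasion.networkValue S prior k g' = NetworkPersuasion.privateValue S prior k :=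
  NetworkPersuasion.exists_extension_of_isHalo S prior hprior_pos hprior_sum hk hprior g C hC hkC
    hCn hexc
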